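/- **Theorem 2 (slow-rate oracle inequality for the time-varying Lasso).** Consider a sequence of models (indexed by $n$; the index is suppressed) with sample size $T$, number of predictors $p_N$, window size $T_0\ge 1$ and target date $t\in\{1,\dots,T\}$, such that $p_N\to\infty$, $T\to\infty$ and $T_0/T\to 0$. For $1\le j\le T$ let $$y_j = x_j'\beta_j^0+\epsilon_j ,\qquad x_j,\beta^0_j\in\mathbb R^{p_N},$$ with deterministic $\beta_j^0$, and suppose, with constants $M,\sigma,C,L,c>0$ that do not depend on $n$: (i) $E(\epsilon_j\mid\mathcal F_{j-1})=0$ and $E(\epsilon_j^2\mid\mathcal F_{j-1})=\sigma^2$, where $\mathcal F_{j-1}=\sigma(x_1,\dots,x_j,\epsilon_1,\dots,\epsilon_{j-1})$; (ii) $E\big(\max_{i\le p_N}|x_{i,j}|^2\big)\le M$ for $1\le j\le T$; (iii) the weights satisfy $0\le w_{tj}\le C$ and $\sum_{j=1}^T w_{tj}\big[1+((j-t)/T_0)^2\big]\le C\,T_0$ (for example $w_{tj}=K((j-t)/T_0)$ with a bounded nonnegative kernel $K$ of compact support); (iv) $\|\beta^0_j-\beta^0_t\|_1\le L\,|j-t|/T$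 for $1\le j\le T$, and $\|\beta_t^0\|_1\ge c$ for all large $n$. Let $\lambda=(\log p_N)^2\,T_0^{-1/2}+T_0/T$ and let $$\hat\beta_t\in\operatorname*{arg\,min}_{\beta\in\mathbb R^{p_N}}\Big\{\frac1{T_0}\sum_{j=1}^T w_{tj}\,(y_j-x_j'\beta)^2+\lambda\|\beta\|_1\Big\}$$ be any minimizer. Then, with probability tending to one, $$\frac1{T_0}\sum_{j=1}^T w_{tj}\big[x_j'(\beta_t^0-\hat\beta_t)\big]^2\le 3\lambda\|\beta_t^0\|_1 .$$ -/

import Mathlib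

open MeasureTheory Filter Topology

namespace TVLasso

/-- The norm `‖b‖₁ = ∑ᵢ |bᵢ|` on `ℝᵖ` (the instance norm on `Fin p → ℝ` is the sup norm). -/
def l1Norm {p : ℕ} (b : Fin p → ℝ) : ℝ := ∑ i, |b i|

/-- The information set `𝓕_{j-1}` generated by `X₁, …, X_j` and `ε₁, …, ε_{j-1}`. -/
@[reducible] def infoSet {Ω : Type*} {p : ℕ} (X : ℕ → Ω → Fin p → ℝ) (ε : ℕ → Ω → ℝ) (j : ℕ) :
    MeasurableSpace Ω :=
  (⨆ s ∈ Finset.Icc 1 j, MeasurableSpace.comap (X s) inferInstance) ⊔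
    (⨆ s ∈ Finset.Ico 1 j, MeasurableSpace.comap (ε s) inferInstance)

/-- `(ε_j)`, `1 ≤ j ≤ T`, is a (conditionally) homoskedastic martingale difference sequence with
variance `σ²`, relative to the information sets generated by the predictors and the past noise. -/
structure IsHomoskedasticMDS {Ω : Type*} [MeasurableSpace Ω] (μ : Measure Ω) {p : ℕ}
    (X : ℕ → Ω → Fin p → ℝ) (ε : ℕ → Ω → ℝ) (T : ℕ) (σ : ℝ) : Prop where
  memLp : ∀ j ∈ Finset.Icc 1 T, MemLp (ε j) 2 μ
  condMean : ∀ j ∈ Finset.Icc 1 T, μ[ε j | infoSet X ε j] =ᵐ[μ] fun _ => 0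
  condVar : ∀ j ∈ Finset.Icc 1 T,
    μ[fun ω => (ε j ω) ^ 2 | infoSet X ε j] =ᵐ[μ] fun _ => σ ^ 2

/-- Nonnegative bounded weights `w_{tj}`, `1 ≤ j ≤ T`, concentrated around `j = t` on the scale
`T₀`: `∑ⱼ w_{tj} (1 + ((j - t)/T₀)²) ≤ C T₀`. Example: `w_{tj} = K((j - t)/T₀)` for a bounded
nonnegative kernel `K` with compact support or Gaussian tails. -/
structure IsLocalWeight (w : ℕ → ℝ) (t T T₀ : ℕ) (C : ℝ) : Prop where
  nonneg : ∀ j ∈ Finset.Icc 1 T, 0 ≤ w j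
  le_const : ∀ j ∈ Finset.Icc 1 T, w j ≤ C
  localized : ∑ j ∈ Finset.Icc 1 T, w j * (1 + (((j : ℝ) - t) / T₀) ^ 2) ≤ C * T₀

/-- The penalty level `λ = (log p)² T₀^{-1/2} + T₀ / T`. -/
noncomputable def penaltyLevel (p T T₀ : ℕ) : ℝ :=
  (Real.log p) ^ 2 / Real.sqrt T₀ + (T₀ : ℝ) / T

/-- `(1/T₀) ∑_{j=1}^T w_j (y_j - x_j' b)² + lam ‖b‖₁`. -/
noncomputable def lassoObjective {p : ℕ} (T T₀ : ℕ) (w y : ℕ → ℝ) (x : ℕ → Fin p → ℝ) (lam : ℝ)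
    (b : Fin p → ℝ) : ℝ :=
  (1 / (T₀ : ℝ)) * ∑ j ∈ Finset.Icc 1 T, w j * (y j - x j ⬝ᵥ b) ^ 2 + lam * l1Norm b

/-- `b` is a (not necessarily unique) minimizer of the Lasso objective over `ℝᵖ`. -/
def IsLasso {p : ℕ} (T T₀ : ℕ) (w y : ℕ → ℝ) (x : ℕ → Fin p → ℝ) (lam : ℝ)
    (b : Fin p → ℝ) : Prop :=
  ∀ b' : Fin p → ℝ, lassoObjective T T₀ w y x lam b ≤ lassoObjective T T₀ w y x lam b'

/-- The weighted in-sample prediction error `(1/T₀) ∑_{j=1}^T w_j [x_j' (β - b)]²`. -/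
noncomputable def predictionError {p : ℕ} (T T₀ : ℕ) (w : ℕ → ℝ) (x : ℕ → Fin p → ℝ)
    (β b : Fin p → ℝ) : ℝ :=
  (1 / (T₀ : ℝ)) * ∑ j ∈ Finset.Icc 1 T, w j * (x j ⬝ᵥ (β - b)) ^ 2

end TVLasso

/-!
Compare the Lasso objective at the estimator `b` and at `β = β₀ t`. Writing `uⱼ = xⱼ'(β - b)`,
Young's inequality absorbs the interaction of `uⱼ` with the drift `dⱼ = xⱼ'(β₀ⱼ - β)`, and
`ℓ¹`-`ℓ^∞` duality bounds its interaction with the noise, so it suffices that the score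
`T₀⁻¹ ∑ⱼ wⱼ εⱼ xⱼ` has sup norm at most `λ / 8` and that `T₀⁻¹ ∑ⱼ wⱼ dⱼ²` is at most
`λ ‖β‖₁ / 8`, with high probability.

The drift term has mean of order `(T₀ / T)²`, and Markov's inequality applies since `λ ≥ T₀ / T`.
The score is a martingale in `ℝᵖ`: its expected sup norm is controlled by the potential
`log ∑ᵢ cosh zᵢ`, which lies within `log (2p)` of the sup norm and is smooth enough for martingale
increments `D` to raise its mean by at most `E ‖D‖² / 2` each. Optimizing over a rescaling of the
martingale bounds the expected sup norm by `√(2 log (2p) ∑ E ‖D‖²)`, of order `√(log p / T₀)`, which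
is negligible against `(log p)² / √T₀`.
-/

namespace TVLasso

section LogSumExp

variable {α : Type*} [MeasurableSpace α] {ν : Measure α} {s : α → ℝ} {r : ℝ}

lemma log_integral_exp_le [IsProbabilityMeasure ν] (hs : AEMeasurable s ν)
    (hsr : ∀ᵐ x ∂ν, |s x| ≤ r) :
    Real.log (∫ x, Real.exp (s x) ∂ν) ≤ ∫ x, s x ∂ν + r ^ 2 / 2 := by
  have hmem : ∀ᵐ x ∂ν, s x ∈ Set.Icc (-r) r := hsr.mono fun _ h => abs_le.1 h
  have hexp : Integrable (fun x => Real.exp (s x)) ν := by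
    simpa only [one_mul] using ProbabilityTheory.integrable_exp_mul_of_mem_Icc (t := 1) hs hmem
  have hhoeffding := (ProbabilityTheory.hasSubgaussianMGF_of_mem_Icc hs hmem).mgf_le 1
  have hproxy : ((((‖r - -r‖₊ / 2) ^ 2 : NNReal) : ℝ)) * 1 ^ 2 / 2 = r ^ 2 / 2 := by
    rw [NNReal.coe_pow, NNReal.coe_div, coe_nnnorm, div_pow, Real.norm_eq_abs, sq_abs,
      NNReal.coe_ofNat]
    ring
  simp only [ProbabilityTheory.mgf, one_mul, Real.exp_sub, integral_div, hproxy] at hhoeffding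
  rw [div_le_iff₀ (Real.exp_pos _), ← Real.exp_add, add_comm] at hhoeffding
  exact (Real.log_le_iff_le_exp (integral_exp_pos hexp)).2 hhoeffding

lemma log_integral_exp_add_le [NeZero ν] {z : α → ℝ}
    (hz : Integrable (fun x => Real.exp (z x)) ν) (hs : AEMeasurable s ν)
    (hsr : ∀ᵐ x ∂ν, |s x| ≤ r) :
    Real.log (∫ x, Real.exp (z x + s x) ∂ν) ≤
      Real.log (∫ x, Real.exp (z x) ∂ν) + (∫ x, s x ∂ν.tilted z + r ^ 2 / 2) := by
  have := isProbabilityMeasure_tilted hz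
  have hac := tilted_absolutelyContinuous ν z
  have hpos : 0 < ∫ x, Real.exp (z x) ∂ν := integral_exp_pos hz
  have htilt : ∫ x, Real.exp (z x + s x) ∂ν =
      (∫ x, Real.exp (z x) ∂ν) * ∫ x, Real.exp (s x) ∂ν.tilted z := by
    rw [integral_exp_tilted, mul_div_cancel₀ _ hpos.ne']
    rfl
  have hpos' : 0 < ∫ x, Real.exp (s x) ∂ν.tilted z := by
    refine integral_exp_pos ?_
    simpa only [one_mul] using ProbabilityTheory.integrable_exp_mul_of_mem_Icc (t := 1)
      (hs.mono_ac hac) (hac.ae_le (hsr.mono fun _ h => abs_le.1 h))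
  rw [htilt, Real.log_mul hpos.ne' hpos'.ne']
  gcongr
  exact log_integral_exp_le (hs.mono_ac hac) (hac.ae_le hsr)

end LogSumExp

section SmoothPotential

/-- A potential `Φ` with continuous slopes `Φ'`, bounded by `c`, that exceeds its linearization by
at most `K ‖s‖²`. Nothing forces `Φ'` to be the derivative: only this one-sided second-order bound
enters the martingale argument. -/
structure IsSmoothPotential {E : Type*} [NormedAddCommGroup E] [NormedSpace ℝ E]
    (Φ : E → ℝ) (Φ' : E → E →L[ℝ] ℝ) (c K : ℝ) : Prop where
  continuous : Continuous Φ
  continuous_slope : Continuous Φ'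
  norm_slope_le : ∀ z, ‖Φ' z‖ ≤ c
  add_le : ∀ z s, Φ (z + s) ≤ Φ z + Φ' z s + K * ‖s‖ ^ 2

variable {ι : Type*} [Fintype ι]

/-- The smooth surrogate `log ∑ᵢ cosh zᵢ` of the sup norm `maxᵢ |zᵢ|`. -/
noncomputable def logSumCosh (z : ι → ℝ) : ℝ :=
  Real.log (∑ i, Real.cosh (z i))

/-- The derivative of `logSumCosh` at `z`. -/
noncomputable def logSumCoshDeriv (z : ι → ℝ) : (ι → ℝ) →L[ℝ] ℝ :=
  (∑ i, Real.cosh (z i))⁻¹ • ∑ i, Real.sinh (z i) • ContinuousLinearMap.proj i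

lemma logSumCoshDeriv_apply (z s : ι → ℝ) :
    logSumCoshDeriv z s = (∑ i, Real.sinh (z i) * s i) / ∑ i, Real.cosh (z i) := by
  simp [logSumCoshDeriv, div_eq_inv_mul]

lemma norm_logSumCoshDeriv_le (z : ι → ℝ) : ‖logSumCoshDeriv z‖ ≤ 1 := by
  refine ContinuousLinearMap.opNorm_le_bound _ zero_le_one fun s => ?_
  have hcosh : 0 ≤ ∑ i, Real.cosh (z i) := Finset.sum_nonneg fun i _ => (Real.cosh_pos _).le
  rw [logSumCoshDeriv_apply, norm_div, one_mul, Real.norm_of_nonneg hcosh]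
  refine div_le_of_le_mul₀ hcosh (norm_nonneg s) ?_
  rw [Finset.mul_sum]
  refine norm_sum_le_of_le _ fun i _ => ?_
  rw [norm_mul, mul_comm]
  gcongr
  · exact norm_le_pi_norm s i
  · rw [Real.norm_eq_abs, Real.abs_sinh, ← Real.cosh_abs]
    exact (Real.sinh_lt_cosh _).le

lemma logSumCosh_zero : logSumCosh (0 : ι → ℝ) = Real.log (Fintype.card ι) := by
  simp [logSumCosh]

variable [Nonempty ι]

lemma sum_cosh_pos (z : ι → ℝ) : 0 < ∑ i, Real.cosh (z i) :=
  Finset.sum_pos (fun i _ => Real.cosh_pos (z i)) Finset.univ_nonempty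

lemma norm_le_log_two_add_logSumCosh (z : ι → ℝ) : ‖z‖ ≤ Real.log 2 + logSumCosh z := by
  refine (pi_norm_le_iff_of_nonempty z).2 fun i => ?_
  rw [logSumCosh, ← Real.log_mul two_ne_zero (sum_cosh_pos z).ne',
    Real.le_log_iff_exp_le (mul_pos two_pos (sum_cosh_pos z))]
  calc Real.exp |z i| ≤ 2 * Real.cosh (z i) := by
        rw [← Real.cosh_abs, Real.cosh_eq]
        linarith [Real.exp_pos (-|z i|)]
    _ ≤ 2 * ∑ i, Real.cosh (z i) := by
        gcongr
        exact Finset.single_le_sum (f := fun i => Real.cosh (z i))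
          (fun i _ => (Real.cosh_pos _).le) (Finset.mem_univ i)

-- `2 ∑ᵢ cosh zᵢ` is the integral of `exp` over the `2 |ι|` atoms `±zᵢ`.
lemma logSumCosh_add_le (z s : ι → ℝ) :
    logSumCosh (z + s) ≤ logSumCosh z + logSumCoshDeriv z s + 2⁻¹ * ‖s‖ ^ 2 := by
  let : MeasurableSpace (ι ⊕ ι) := ⊤
  have : MeasurableSingletonClass (ι ⊕ ι) := ⟨fun _ => trivial⟩
  let double (u : ι → ℝ) : ι ⊕ ι → ℝ := Sum.elim u (-u)
  have hdouble (u : ι → ℝ) :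
      ∫ k, Real.exp (double u k) ∂Measure.count = 2 * ∑ i, Real.cosh (u i) := by
    simp only [double, integral_count, Fintype.sum_sum_type, Sum.elim_inl, Sum.elim_inr,
      Pi.neg_apply, Real.cosh_eq, ← Finset.sum_add_distrib, ← Finset.sum_div]
    ring
  have hlog (u : ι → ℝ) : Real.log (∫ k, Real.exp (double u k) ∂Measure.count) =
      Real.log 2 + logSumCosh u := by
    rw [hdouble, Real.log_mul two_ne_zero (sum_cosh_pos u).ne', logSumCosh]
  have hmean : ∫ k, double s k ∂Measure.count.tilted (double z) = logSumCoshDeriv z s := by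
    simp only [integral_tilted, hdouble, integral_count, Fintype.sum_sum_type, double,
      Sum.elim_inl, Sum.elim_inr, Pi.neg_apply, logSumCoshDeriv_apply, Real.sinh_eq,
      ← Finset.sum_add_distrib, Finset.sum_div, smul_eq_mul]
    refine Finset.sum_congr rfl fun i _ => ?_
    field_simp
    ring
  have hadd (k : ι ⊕ ι) : double z k + double s k = double (z + s) k := by
    cases k <;> simp [double, add_comm]
  have hstep := log_integral_exp_add_le (ν := Measure.count) (z := double z) (s := double s)
    (r := ‖s‖) .of_finite measurable_from_top.aemeasurable
    (ae_of_all _ (Sum.rec (norm_le_pi_norm s) fun i => by simpa [double] using norm_le_pi_norm s i))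
  simp only [hadd, hlog, hmean] at hstep
  linarith

lemma isSmoothPotential_logSumCosh :
    IsSmoothPotential (logSumCosh (ι := ι)) logSumCoshDeriv 1 2⁻¹ where
  continuous := Continuous.log (by fun_prop) fun z => (sum_cosh_pos z).ne'
  continuous_slope := .smul (.inv₀ (by fun_prop) fun z => (sum_cosh_pos z).ne') (by fun_prop)
  norm_slope_le := norm_logSumCoshDeriv_le
  add_le := logSumCosh_add_le

end SmoothPotential

section Martingale

/-- `D₁, …, Dₙ` is a square-integrable martingale difference sequence relative to the σ-algebras
`m₁, …, mₙ`, where `mₖ` carries the information available before `Dₖ` is revealed. The `mₖ` need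
not increase: only the measurability of the past differences matters. -/
structure IsL2MartingaleDifference {Ω E : Type*} {m0 : MeasurableSpace Ω} [NormedAddCommGroup E]
    [NormedSpace ℝ E] [CompleteSpace E] (μ : Measure Ω) (m : ℕ → MeasurableSpace Ω)
    (D : ℕ → Ω → E) (n : ℕ) : Prop where
  le : ∀ k ∈ Finset.Icc 1 n, m k ≤ m0
  stronglyMeasurable : ∀ k ∈ Finset.Icc 1 n, ∀ i ∈ Finset.Ico 1 k, StronglyMeasurable[m k] (D i)
  memLp : ∀ k ∈ Finset.Icc 1 n, MemLp (D k) 2 μ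
  condExp_eq_zero : ∀ k ∈ Finset.Icc 1 n, μ[D k | m k] =ᵐ[μ] 0

variable {Ω E : Type*} {m m0 : MeasurableSpace Ω} {μ : Measure Ω} [NormedAddCommGroup E]
  [NormedSpace ℝ E] {Φ : E → ℝ} {Φ' : E → E →L[ℝ] ℝ} {c K : ℝ}

lemma IsSmoothPotential.integrable_comp [IsFiniteMeasure μ] {S : Ω → E}
    (hΦ : IsSmoothPotential Φ Φ' c K) (hS : MemLp S 2 μ) : Integrable (fun ω => Φ (S ω)) μ := by
  have hslope (u s : E) : |Φ' u s| ≤ c * ‖s‖ := (Φ' u).le_of_opNorm_le (hΦ.norm_slope_le u) s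
  have hbound (z : E) : ‖Φ z‖ ≤ |Φ 0| + c * ‖z‖ + K * ‖z‖ ^ 2 := by
    have hupper := hΦ.add_le 0 z
    have hlower := hΦ.add_le z (-z)
    rw [zero_add] at hupper
    rw [add_neg_cancel, map_neg, norm_neg] at hlower
    rw [Real.norm_eq_abs, abs_le]
    constructor <;> linarith [abs_le.1 (hslope 0 z), abs_le.1 (hslope z z), neg_abs_le (Φ 0),
      le_abs_self (Φ 0)]
  have hmajorant : Integrable (fun ω => |Φ 0| + c * ‖S ω‖ + K * ‖S ω‖ ^ 2) μ :=
    ((integrable_const _).add ((hS.integrable one_le_two).norm.const_mul c)).add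
      ((hS.integrable_norm_pow two_ne_zero).const_mul K)
  exact hmajorant.mono' (hΦ.continuous.comp_aestronglyMeasurable hS.aestronglyMeasurable)
    (ae_of_all _ fun ω => hbound (S ω))

variable [CompleteSpace E]

lemma integral_clm_apply_eq_zero [IsFiniteMeasure μ] (hm : m ≤ m0) {A : Ω → E →L[ℝ] ℝ} {D : Ω → E}
    (hA : StronglyMeasurable[m] A) (hAc : ∀ ω, ‖A ω‖ ≤ c) (hD : Integrable D μ)
    (hD0 : μ[D | m] =ᵐ[μ] 0) : ∫ ω, A ω (D ω) ∂μ = 0 := by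
  have hpull := condExp_stronglyMeasurable_bilin_of_bound (.id ℝ _) hm hA hD c (ae_of_all _ hAc)
  rw [← integral_condExp hm]
  refine integral_eq_zero_of_ae ?_
  filter_upwards [hpull, hD0] with ω hω hω0
  simp_all

lemma IsSmoothPotential.integral_comp_add_le [IsFiniteMeasure μ]
    (hΦ : IsSmoothPotential Φ Φ' c K) (hm : m ≤ m0) {S D : Ω → E} (hSm : StronglyMeasurable[m] S)
    (hS : MemLp S 2 μ) (hD : MemLp D 2 μ) (hD0 : μ[D | m] =ᵐ[μ] 0) :
    ∫ ω, Φ (S ω + D ω) ∂μ ≤ ∫ ω, Φ (S ω) ∂μ + K * ∫ ω, ‖D ω‖ ^ 2 ∂μ := by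
  have hDint := hD.integrable one_le_two
  have hA : StronglyMeasurable[m] fun ω => Φ' (S ω) :=
    hΦ.continuous_slope.comp_stronglyMeasurable hSm
  have hlin : Integrable (fun ω => Φ' (S ω) (D ω)) μ :=
    (ContinuousLinearMap.id ℝ (E →L[ℝ] ℝ)).integrable_of_bilin_of_bdd_left c
      (hA.mono hm).aestronglyMeasurable (ae_of_all _ fun _ => hΦ.norm_slope_le _) hDint
  have hfirst : Integrable (fun ω => Φ (S ω) + Φ' (S ω) (D ω)) μ :=
    (hΦ.integrable_comp hS).add hlin
  have hquad := (hD.integrable_norm_pow two_ne_zero).const_mul K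
  calc ∫ ω, Φ (S ω + D ω) ∂μ
      ≤ ∫ ω, (Φ (S ω) + Φ' (S ω) (D ω) + K * ‖D ω‖ ^ 2) ∂μ :=
        integral_mono (hΦ.integrable_comp (hS.add hD)) (hfirst.add hquad)
          fun ω => hΦ.add_le (S ω) (D ω)
    _ = ∫ ω, Φ (S ω) ∂μ + K * ∫ ω, ‖D ω‖ ^ 2 ∂μ := by
        rw [integral_add hfirst hquad, integral_add (hΦ.integrable_comp hS) hlin,
          integral_const_mul,
          integral_clm_apply_eq_zero hm hA (fun _ => hΦ.norm_slope_le _) hDint hD0, add_zero]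

namespace IsL2MartingaleDifference

variable {F : ℕ → MeasurableSpace Ω} {D : ℕ → Ω → E} {n : ℕ}

lemma mono (hD : IsL2MartingaleDifference μ F D n) {k : ℕ} (hk : k ≤ n) :
    IsL2MartingaleDifference μ F D k where
  le i hi := hD.le i (Finset.Icc_subset_Icc_right hk hi)
  stronglyMeasurable i hi := hD.stronglyMeasurable i (Finset.Icc_subset_Icc_right hk hi)
  memLp i hi := hD.memLp i (Finset.Icc_subset_Icc_right hk hi)
  condExp_eq_zero i hi := hD.condExp_eq_zero i (Finset.Icc_subset_Icc_right hk hi)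

lemma smul (hD : IsL2MartingaleDifference μ F D n) (a : ℕ → ℝ) :
    IsL2MartingaleDifference μ F (fun k ω => a k • D k ω) n where
  le := hD.le
  stronglyMeasurable k hk i hi := (hD.stronglyMeasurable k hk i hi).const_smul (a i)
  memLp k hk := (hD.memLp k hk).const_smul (a k)
  condExp_eq_zero k hk := by
    filter_upwards [condExp_smul (a k) (D k) (F k), hD.condExp_eq_zero k hk] with ω hω hω0
    exact hω.trans (by simp [hω0])

lemma memLp_sum (hD : IsL2MartingaleDifference μ F D n) :
    MemLp (fun ω => ∑ k ∈ Finset.Icc 1 n, D k ω) 2 μ :=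
  memLp_finsetSum _ hD.memLp

lemma integral_comp_sum_le [IsProbabilityMeasure μ] (hΦ : IsSmoothPotential Φ Φ' c K)
    (hD : IsL2MartingaleDifference μ F D n) :
    ∫ ω, Φ (∑ k ∈ Finset.Icc 1 n, D k ω) ∂μ ≤
      Φ 0 + K * ∑ k ∈ Finset.Icc 1 n, ∫ ω, ‖D k ω‖ ^ 2 ∂μ := by
  induction n with
  | zero => simp
  | succ n ih =>
    have hlast : n + 1 ∈ Finset.Icc 1 (n + 1) := Finset.right_mem_Icc.2 n.succ_pos
    have hpast : StronglyMeasurable[F (n + 1)] fun ω => ∑ k ∈ Finset.Icc 1 n, D k ω :=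
      Finset.stronglyMeasurable_fun_sum _ fun i hi =>
        hD.stronglyMeasurable _ hlast i (Finset.mem_Ico.2 (by grind))
    have hstep := hΦ.integral_comp_add_le (hD.le _ hlast) hpast (hD.mono n.le_succ).memLp_sum
      (hD.memLp _ hlast) (hD.condExp_eq_zero _ hlast)
    simp only [Finset.sum_Icc_succ_top (Nat.le_add_left 1 n), mul_add]
    linarith [ih (hD.mono n.le_succ)]

variable {ι : Type*} [Fintype ι] [Nonempty ι] {D : ℕ → Ω → ι → ℝ}

lemma integral_norm_sum_le [IsProbabilityMeasure μ] (hD : IsL2MartingaleDifference μ F D n) :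
    ∫ ω, ‖∑ k ∈ Finset.Icc 1 n, D k ω‖ ∂μ ≤
      Real.log (2 * Fintype.card ι) + 2⁻¹ * ∑ k ∈ Finset.Icc 1 n, ∫ ω, ‖D k ω‖ ^ 2 ∂μ := by
  have hpot := isSmoothPotential_logSumCosh.integrable_comp hD.memLp_sum
  calc ∫ ω, ‖∑ k ∈ Finset.Icc 1 n, D k ω‖ ∂μ
      ≤ ∫ ω, (Real.log 2 + logSumCosh (∑ k ∈ Finset.Icc 1 n, D k ω)) ∂μ :=
        integral_mono (hD.memLp_sum.integrable one_le_two).norm ((integrable_const _).add hpot)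
          fun ω => norm_le_log_two_add_logSumCosh _
    _ = Real.log 2 + ∫ ω, logSumCosh (∑ k ∈ Finset.Icc 1 n, D k ω) ∂μ := by
        rw [integral_add (integrable_const _) hpot, integral_const, probReal_univ, one_smul]
    _ ≤ _ := by
        rw [Real.log_mul two_ne_zero (by exact_mod_cast Fintype.card_ne_zero), add_assoc,
          ← logSumCosh_zero]
        gcongr
        exact hD.integral_comp_sum_le isSmoothPotential_logSumCosh

lemma sq_integral_norm_sum_le [IsProbabilityMeasure μ] (hD : IsL2MartingaleDifference μ F D n) :
    (∫ ω, ‖∑ k ∈ Finset.Icc 1 n, D k ω‖ ∂μ) ^ 2 ≤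
      2 * Real.log (2 * Fintype.card ι) * ∑ k ∈ Finset.Icc 1 n, ∫ ω, ‖D k ω‖ ^ 2 ∂μ := by
  have hscaled (θ : ℝ) :
      0 ≤ 2⁻¹ * (∑ k ∈ Finset.Icc 1 n, ∫ ω, ‖D k ω‖ ^ 2 ∂μ) * (θ * θ) +
        -(∫ ω, ‖∑ k ∈ Finset.Icc 1 n, D k ω‖ ∂μ) * θ + Real.log (2 * Fintype.card ι) := by
    have h := (hD.smul fun _ => θ).integral_norm_sum_le
    simp only [← Finset.smul_sum, norm_smul, mul_pow, integral_const_mul, ← Finset.mul_sum,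
      Real.norm_eq_abs, sq_abs] at h
    have hθ := mul_le_mul_of_nonneg_right (le_abs_self θ)
      (integral_nonneg fun ω => norm_nonneg (∑ k ∈ Finset.Icc 1 n, D k ω) :
        0 ≤ ∫ ω, ‖∑ k ∈ Finset.Icc 1 n, D k ω‖ ∂μ)
    linarith
  have hdiscrim := discrim_le_zero hscaled
  rw [discrim, neg_sq] at hdiscrim
  linarith

end IsL2MartingaleDifference

end Martingale

section ConditionalVariance

variable {Ω E : Type*} {m m0 : MeasurableSpace Ω} {μ : Measure Ω} [IsFiniteMeasure μ] {v : ℝ}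

lemma lintegral_ofReal_mul_le_of_condExp_le (hm : m ≤ m0) {f : Ω → ℝ} {g : Ω → ENNReal}
    (hf : Integrable f μ) (hf0 : 0 ≤ᵐ[μ] f) (hfv : μ[f | m] ≤ᵐ[μ] fun _ => v)
    (hg : Measurable[m] g) :
    ∫⁻ ω, ENNReal.ofReal (f ω) * g ω ∂μ ≤ ENNReal.ofReal v * ∫⁻ ω, g ω ∂μ := by
  have hdensity : (μ.withDensity fun ω => ENNReal.ofReal (f ω)).trim hm ≤
      ENNReal.ofReal v • μ.trim hm := by
    refine Measure.le_intro fun A hA _ => ?_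
    rw [trim_measurableSet_eq hm hA, Measure.smul_apply, trim_measurableSet_eq hm hA,
      withDensity_apply _ (hm A hA),
      ← ofReal_integral_eq_lintegral_ofReal hf.integrableOn (ae_restrict_of_ae hf0),
      ← setIntegral_condExp hm hf hA, smul_eq_mul, ← ofReal_measureReal,
      ← ENNReal.ofReal_mul' measureReal_nonneg]
    refine ENNReal.ofReal_le_ofReal ?_
    calc ∫ ω in A, (μ[f | m]) ω ∂μ ≤ ∫ _ in A, v ∂μ :=
          setIntegral_mono_ae integrable_condExp.integrableOn (integrable_const v).integrableOn hfv
      _ = v * μ.real A := by rw [setIntegral_const, smul_eq_mul, mul_comm]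
  calc ∫⁻ ω, ENNReal.ofReal (f ω) * g ω ∂μ
      = ∫⁻ ω, g ω ∂(μ.withDensity fun ω => ENNReal.ofReal (f ω)).trim hm := by
        rw [lintegral_trim hm hg, lintegral_withDensity_eq_lintegral_mul₀
          hf.aemeasurable.ennreal_ofReal (hg.mono hm le_rfl).aemeasurable]
        rfl
    _ ≤ ∫⁻ ω, g ω ∂(ENNReal.ofReal v • μ.trim hm) := lintegral_mono' hdensity le_rfl
    _ = ENNReal.ofReal v * ∫⁻ ω, g ω ∂μ := by
        rw [lintegral_smul_measure, lintegral_trim hm hg, smul_eq_mul]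

variable [NormedAddCommGroup E] [NormedSpace ℝ E] {e : Ω → ℝ} {x : Ω → E}

lemma lintegral_ofReal_norm_smul_sq_le (hm : m ≤ m0) (he : MemLp e 2 μ)
    (hev : μ[fun ω => e ω ^ 2 | m] ≤ᵐ[μ] fun _ => v) (hv : 0 ≤ v) (hxm : StronglyMeasurable[m] x)
    (hx : MemLp x 2 μ) :
    ∫⁻ ω, ENNReal.ofReal (‖e ω • x ω‖ ^ 2) ∂μ ≤ ENNReal.ofReal (v * ∫ ω, ‖x ω‖ ^ 2 ∂μ) := by
  have hbound := lintegral_ofReal_mul_le_of_condExp_le hm he.integrable_sq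
    (ae_of_all _ fun _ => sq_nonneg _) hev (hxm.norm.measurable.pow_const 2).ennreal_ofReal
  rw [← ofReal_integral_eq_lintegral_ofReal (hx.integrable_norm_pow two_ne_zero)
    (ae_of_all _ fun _ => sq_nonneg _), ← ENNReal.ofReal_mul hv] at hbound
  simpa only [norm_smul, mul_pow, Real.norm_eq_abs, sq_abs,
    ENNReal.ofReal_mul (sq_nonneg (e _))] using hbound

lemma memLp_smul_of_condExp_sq_le (hm : m ≤ m0) (he : MemLp e 2 μ)
    (hev : μ[fun ω => e ω ^ 2 | m] ≤ᵐ[μ] fun _ => v) (hv : 0 ≤ v) (hxm : StronglyMeasurable[m] x)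
    (hx : MemLp x 2 μ) : MemLp (fun ω => e ω • x ω) 2 μ := by
  have hmeas : AEStronglyMeasurable (fun ω => e ω • x ω) μ :=
    he.aestronglyMeasurable.smul hx.aestronglyMeasurable
  refine (memLp_two_iff_integrable_sq_norm hmeas).2 ?_
  refine (lintegral_ofReal_ne_top_iff_integrable (hmeas.norm.pow 2)
    (ae_of_all _ fun _ => sq_nonneg _)).1 ?_
  exact ((lintegral_ofReal_norm_smul_sq_le hm he hev hv hxm hx).trans_lt
    ENNReal.ofReal_lt_top).ne

lemma integral_norm_smul_sq_le (hm : m ≤ m0) (he : MemLp e 2 μ)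
    (hev : μ[fun ω => e ω ^ 2 | m] ≤ᵐ[μ] fun _ => v) (hv : 0 ≤ v) (hxm : StronglyMeasurable[m] x)
    (hx : MemLp x 2 μ) : ∫ ω, ‖e ω • x ω‖ ^ 2 ∂μ ≤ v * ∫ ω, ‖x ω‖ ^ 2 ∂μ := by
  have hmeas : AEStronglyMeasurable (fun ω => ‖e ω • x ω‖ ^ 2) μ :=
    (he.aestronglyMeasurable.smul hx.aestronglyMeasurable).norm.pow 2
  rw [integral_eq_lintegral_of_nonneg_ae (ae_of_all _ fun _ => sq_nonneg _) hmeas]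
  exact ENNReal.toReal_le_of_le_ofReal (mul_nonneg hv (integral_nonneg fun _ => sq_nonneg _))
    (lintegral_ofReal_norm_smul_sq_le hm he hev hv hxm hx)

end ConditionalVariance

section Deterministic

variable {p T T₀ t : ℕ} {w y e : ℕ → ℝ} {x β₀ : ℕ → Fin p → ℝ} {lam C : ℝ} {β b : Fin p → ℝ}

/-- The weighted noise score `T₀⁻¹ ∑ⱼ wⱼ eⱼ xⱼ`, with the deterministic factor `wⱼ / T₀` set apart
from the random `eⱼ xⱼ`. -/
noncomputable def noiseScore {p : ℕ} (T T₀ : ℕ) (w e : ℕ → ℝ) (x : ℕ → Fin p → ℝ) : Fin p → ℝ :=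
  ∑ j ∈ Finset.Icc 1 T, (w j / T₀) • e j • x j

/-- The weighted squared error `T₀⁻¹ ∑ⱼ wⱼ [xⱼ' (β₀ⱼ - β)]²` from treating the time-varying
coefficients as constantly equal to `β`. -/
noncomputable def driftError {p : ℕ} (T T₀ : ℕ) (w : ℕ → ℝ) (x β₀ : ℕ → Fin p → ℝ)
    (β : Fin p → ℝ) : ℝ :=
  (1 / (T₀ : ℝ)) * ∑ j ∈ Finset.Icc 1 T, w j * (x j ⬝ᵥ (β₀ j - β)) ^ 2

lemma driftError_nonneg (hw : ∀ j ∈ Finset.Icc 1 T, 0 ≤ w j) :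
    0 ≤ driftError T T₀ w x β₀ β :=
  mul_nonneg (by positivity)
    (Finset.sum_nonneg fun j hj => mul_nonneg (hw j hj) (sq_nonneg _))

lemma l1Norm_nonneg (b : Fin p → ℝ) : 0 ≤ l1Norm b :=
  Finset.sum_nonneg fun _ _ => abs_nonneg _

lemma l1Norm_sub_le (a b : Fin p → ℝ) : l1Norm (a - b) ≤ l1Norm a + l1Norm b := by
  simp only [l1Norm, ← Finset.sum_add_distrib]
  exact Finset.sum_le_sum fun i _ => abs_sub (a i) (b i)

lemma abs_dotProduct_le (x b : Fin p → ℝ) : |x ⬝ᵥ b| ≤ ‖x‖ * l1Norm b := by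
  rw [dotProduct, l1Norm, Finset.mul_sum]
  refine (Finset.abs_sum_le_sum_abs _ _).trans (Finset.sum_le_sum fun i _ => ?_)
  rw [abs_mul]
  exact mul_le_mul_of_nonneg_right (norm_le_pi_norm x i) (abs_nonneg _)

lemma noiseScore_dotProduct (b : Fin p → ℝ) :
    noiseScore T T₀ w e x ⬝ᵥ b =
      (1 / (T₀ : ℝ)) * ∑ j ∈ Finset.Icc 1 T, w j * e j * (x j ⬝ᵥ b) := by
  simp only [noiseScore, sum_dotProduct, smul_dotProduct, smul_eq_mul, Finset.mul_sum]
  exact Finset.sum_congr rfl fun j _ => by ring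

-- With `u = x'(β - b)` and `d` the drift, `(u + d + e)² - (d + e)² ≥ u² / 2 - 2d² + 2ue`.
lemma predictionError_sub_le_residual_sub (hw : ∀ j ∈ Finset.Icc 1 T, 0 ≤ w j)
    (hy : ∀ j ∈ Finset.Icc 1 T, y j = x j ⬝ᵥ β₀ j + e j) :
    predictionError T T₀ w x β b / 2 - 2 * driftError T T₀ w x β₀ β
        + 2 * (noiseScore T T₀ w e x ⬝ᵥ (β - b)) ≤
      (1 / (T₀ : ℝ)) * ∑ j ∈ Finset.Icc 1 T, w j * (y j - x j ⬝ᵥ b) ^ 2 -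
        (1 / (T₀ : ℝ)) * ∑ j ∈ Finset.Icc 1 T, w j * (y j - x j ⬝ᵥ β) ^ 2 := by
  rw [← mul_sub, ← Finset.sum_sub_distrib]
  calc predictionError T T₀ w x β b / 2 - 2 * driftError T T₀ w x β₀ β
        + 2 * (noiseScore T T₀ w e x ⬝ᵥ (β - b))
      = (1 / (T₀ : ℝ)) * ∑ j ∈ Finset.Icc 1 T, (w j * (x j ⬝ᵥ (β - b)) ^ 2 / 2
          - 2 * (w j * (x j ⬝ᵥ (β₀ j - β)) ^ 2) + 2 * (w j * e j * (x j ⬝ᵥ (β - b)))) := by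
        rw [noiseScore_dotProduct, predictionError, driftError, Finset.sum_add_distrib,
          Finset.sum_sub_distrib, ← Finset.sum_div, ← Finset.mul_sum, ← Finset.mul_sum]
        ring
    _ ≤ _ := by
        refine mul_le_mul_of_nonneg_left (Finset.sum_le_sum fun j hj => ?_) (by positivity)
        rw [hy j hj, dotProduct_sub, dotProduct_sub]
        linarith [mul_nonneg (hw j hj)
          (sq_nonneg (x j ⬝ᵥ β - x j ⬝ᵥ b + 2 * (x j ⬝ᵥ β₀ j - x j ⬝ᵥ β)))]

lemma IsLasso.predictionError_le (hb : IsLasso T T₀ w y x lam b)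
    (hw : ∀ j ∈ Finset.Icc 1 T, 0 ≤ w j) (hy : ∀ j ∈ Finset.Icc 1 T, y j = x j ⬝ᵥ β₀ j + e j) :
    predictionError T T₀ w x β b ≤ 2 * lam * (l1Norm β - l1Norm b)
      + 4 * (‖noiseScore T T₀ w e x‖ * (l1Norm β + l1Norm b)) + 4 * driftError T T₀ w x β₀ β := by
  have hmin : lassoObjective T T₀ w y x lam b ≤ lassoObjective T T₀ w y x lam β := hb β
  have hexpand := predictionError_sub_le_residual_sub (T₀ := T₀) (β := β) (b := b) hw hy
  have hduality : |noiseScore T T₀ w e x ⬝ᵥ (β - b)| ≤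
      ‖noiseScore T T₀ w e x‖ * (l1Norm β + l1Norm b) :=
    (abs_dotProduct_le _ _).trans (by gcongr; exact l1Norm_sub_le β b)
  rw [lassoObjective, lassoObjective] at hmin
  linarith [neg_abs_le (noiseScore T T₀ w e x ⬝ᵥ (β - b))]

lemma IsLasso.predictionError_le_three_mul (hb : IsLasso T T₀ w y x lam b)
    (hw : ∀ j ∈ Finset.Icc 1 T, 0 ≤ w j) (hy : ∀ j ∈ Finset.Icc 1 T, y j = x j ⬝ᵥ β₀ j + e j)
    (hlam : 0 ≤ lam) (hnoise : ‖noiseScore T T₀ w e x‖ ≤ lam / 8)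
    (hdrift : driftError T T₀ w x β₀ β ≤ lam * l1Norm β / 8) :
    predictionError T T₀ w x β b ≤ 3 * lam * l1Norm β := by
  have hnoise' : ‖noiseScore T T₀ w e x‖ * (l1Norm β + l1Norm b) ≤
      lam / 8 * (l1Norm β + l1Norm b) :=
    mul_le_mul_of_nonneg_right hnoise (add_nonneg (l1Norm_nonneg β) (l1Norm_nonneg b))
  linarith [hb.predictionError_le hw hy (β := β), mul_nonneg hlam (l1Norm_nonneg b)]

lemma sq_log_div_sqrt_le_penaltyLevel : Real.log p ^ 2 / √T₀ ≤ penaltyLevel p T T₀ :=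
  le_add_of_nonneg_right (by positivity)

lemma div_le_penaltyLevel : (T₀ : ℝ) / T ≤ penaltyLevel p T T₀ :=
  le_add_of_nonneg_left (by positivity)

namespace IsLocalWeight

lemma const_nonneg (hw : IsLocalWeight w t T T₀ C) (hT₀ : 1 ≤ T₀) : 0 ≤ C := by
  have h0 : (0 : ℝ) < T₀ := by exact_mod_cast hT₀
  have h : 0 ≤ C * T₀ := le_trans
    (Finset.sum_nonneg fun j hj => mul_nonneg (hw.nonneg j hj) (by positivity)) hw.localized
  exact nonneg_of_mul_nonneg_left h h0

lemma sum_sq_le (hw : IsLocalWeight w t T T₀ C) (hT₀ : 1 ≤ T₀) :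
    ∑ j ∈ Finset.Icc 1 T, w j ^ 2 ≤ C ^ 2 * T₀ := by
  have hC := hw.const_nonneg hT₀
  calc ∑ j ∈ Finset.Icc 1 T, w j ^ 2
      ≤ ∑ j ∈ Finset.Icc 1 T, C * (w j * (1 + (((j : ℝ) - t) / T₀) ^ 2)) := by
        refine Finset.sum_le_sum fun j hj => ?_
        have hwj := hw.nonneg j hj
        rw [sq]
        gcongr
        · exact hw.le_const j hj
        · exact le_mul_of_one_le_right hwj (le_add_of_nonneg_right (sq_nonneg _))
    _ ≤ C * (C * T₀) := by
        rw [← Finset.mul_sum]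
        exact mul_le_mul_of_nonneg_left hw.localized hC
    _ = C ^ 2 * T₀ := by ring

lemma sum_mul_sq_le (hw : IsLocalWeight w t T T₀ C) (hT₀ : 1 ≤ T₀) :
    (1 / (T₀ : ℝ)) * ∑ j ∈ Finset.Icc 1 T, w j * (|(j : ℝ) - t| / T) ^ 2 ≤
      C * ((T₀ : ℝ) / T) ^ 2 := by
  have : (0 : ℝ) < T₀ := by exact_mod_cast hT₀
  have hrescale (j : ℕ) : (|(j : ℝ) - t| / T) ^ 2 =
      ((T₀ : ℝ) / T) ^ 2 * (((j : ℝ) - t) / T₀) ^ 2 := by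
    rw [div_pow, sq_abs, div_pow, div_pow]
    field_simp
  have hsum : ∑ j ∈ Finset.Icc 1 T, w j * (|(j : ℝ) - t| / T) ^ 2 ≤
      ((T₀ : ℝ) / T) ^ 2 * (C * T₀) := by
    refine le_trans ?_ (mul_le_mul_of_nonneg_left hw.localized (sq_nonneg _))
    rw [Finset.mul_sum]
    refine Finset.sum_le_sum fun j hj => ?_
    have hwj := hw.nonneg j hj
    rw [hrescale, mul_left_comm]
    gcongr
    exact le_add_of_nonneg_left zero_le_one
  calc _ ≤ (1 / (T₀ : ℝ)) * (((T₀ : ℝ) / T) ^ 2 * (C * T₀)) := by gcongr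
    _ = C * ((T₀ : ℝ) / T) ^ 2 := by field_simp

end IsLocalWeight

end Deterministic

lemma measure_ge_le_of_integral_le {Ω : Type*} [MeasurableSpace Ω] {μ : Measure Ω}
    [IsFiniteMeasure μ] {f : Ω → ℝ} (hf : Integrable f μ) (hf0 : ∀ ω, 0 ≤ f ω) {a B : ℝ}
    (ha : 0 < a) (hB : ∫ ω, f ω ∂μ ≤ B) : μ {ω | a ≤ f ω} ≤ ENNReal.ofReal (B / a) := by
  rw [← ofReal_measureReal]
  refine ENNReal.ofReal_le_ofReal ((le_div_iff₀' ha).2 ?_)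
  exact (mul_meas_ge_le_integral_of_nonneg (ae_of_all _ hf0) hf a).trans hB

section BoundedVariance

variable {Ω : Type*} {p T T₀ t : ℕ} {X : ℕ → Ω → Fin p → ℝ} {ε : ℕ → Ω → ℝ}

/-- The heteroskedastic counterpart of `IsHomoskedasticMDS`: the conditional variances need not be
constant, only at most `σ²`. -/
structure IsBoundedVarianceMDS [MeasurableSpace Ω] (μ : Measure Ω) (X : ℕ → Ω → Fin p → ℝ)
    (ε : ℕ → Ω → ℝ) (T : ℕ) (σ : ℝ) : Prop where
  memLp : ∀ j ∈ Finset.Icc 1 T, MemLp (ε j) 2 μ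
  condMean : ∀ j ∈ Finset.Icc 1 T, μ[ε j | infoSet X ε j] =ᵐ[μ] fun _ => 0
  condVar_le : ∀ j ∈ Finset.Icc 1 T,
    μ[fun ω => ε j ω ^ 2 | infoSet X ε j] ≤ᵐ[μ] fun _ => σ ^ 2

lemma measurable_infoSet_predictor {j k : ℕ} (hk : 1 ≤ k) (hkj : k ≤ j) :
    Measurable[infoSet X ε j] (X k) := by
  rw [measurable_iff_comap_le]
  exact le_sup_of_le_left (le_iSup₂_of_le k (Finset.mem_Icc.2 ⟨hk, hkj⟩) le_rfl)

lemma measurable_infoSet_noise {j k : ℕ} (hk : 1 ≤ k) (hkj : k < j) :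
    Measurable[infoSet X ε j] (ε k) := by
  rw [measurable_iff_comap_le]
  exact le_sup_of_le_right (le_iSup₂_of_le k (Finset.mem_Ico.2 ⟨hk, hkj⟩) le_rfl)

lemma stronglyMeasurable_infoSet_self {j : ℕ} (hj : j ∈ Finset.Icc 1 T) :
    StronglyMeasurable[infoSet X ε j] (X j) :=
  (measurable_infoSet_predictor (Finset.mem_Icc.1 hj).1 le_rfl).stronglyMeasurable

variable [m0 : MeasurableSpace Ω]

lemma infoSet_le (hXm : ∀ j ∈ Finset.Icc 1 T, Measurable (X j))
    (hεm : ∀ j ∈ Finset.Icc 1 T, Measurable (ε j)) {j : ℕ} (hj : j ∈ Finset.Icc 1 T) :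
    infoSet X ε j ≤ m0 := by
  have hjT : j ≤ T := (Finset.mem_Icc.1 hj).2
  have hpast : Finset.Ico 1 j ⊆ Finset.Icc 1 T :=
    Finset.Ico_subset_Icc_self.trans (Finset.Icc_subset_Icc_right hjT)
  exact sup_le (iSup₂_le fun k hk => (hXm k (Finset.Icc_subset_Icc_right hjT hk)).comap_le)
    (iSup₂_le fun k hk => (hεm k (hpast hk)).comap_le)

variable {μ : Measure Ω} {σ : ℝ}

lemma IsHomoskedasticMDS.isBoundedVarianceMDS (hε : IsHomoskedasticMDS μ X ε T σ) :
    IsBoundedVarianceMDS μ X ε T σ :=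
  ⟨hε.memLp, hε.condMean, fun j hj => (hε.condVar j hj).le⟩

variable {M C : ℝ} {w : ℕ → ℝ}

namespace IsBoundedVarianceMDS

variable (hε : IsBoundedVarianceMDS μ X ε T σ)
  (hXm : ∀ j ∈ Finset.Icc 1 T, Measurable (X j)) (hεm : ∀ j ∈ Finset.Icc 1 T, Measurable (ε j))
  (hX : ∀ j ∈ Finset.Icc 1 T, MemLp (X j) 2 μ)
include hε hXm hεm hX

lemma isL2MartingaleDifference [IsFiniteMeasure μ] :
    IsL2MartingaleDifference μ (infoSet X ε) (fun j ω => ε j ω • X j ω) T where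
  le _ := infoSet_le hXm hεm
  stronglyMeasurable j _ i hi := by
    obtain ⟨hi1, hij⟩ := Finset.mem_Ico.1 hi
    exact ((measurable_infoSet_noise hi1 hij).smul
      (measurable_infoSet_predictor hi1 hij.le)).stronglyMeasurable
  memLp j hj := memLp_smul_of_condExp_sq_le (infoSet_le hXm hεm hj) (hε.memLp j hj)
    (hε.condVar_le j hj) (sq_nonneg σ) (stronglyMeasurable_infoSet_self hj) (hX j hj)
  condExp_eq_zero j hj := by
    filter_upwards [hε.condMean j hj, condExp_smul_of_aestronglyMeasurable_right
      ((hε.memLp j hj).integrable one_le_two)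
      (memLp_one_iff_integrable.1 ((hX j hj).smul (hε.memLp j hj)))
      (stronglyMeasurable_infoSet_self hj).aestronglyMeasurable] with ω hmean hpull
    exact hpull.trans (by simp [hmean])

lemma integrable_noiseScore [IsFiniteMeasure μ] :
    Integrable (fun ω => noiseScore T T₀ w (fun j => ε j ω) fun j => X j ω) μ :=
  ((hε.isL2MartingaleDifference hXm hεm hX).smul fun j => w j / T₀).memLp_sum.integrable one_le_two

variable (hXM : ∀ j ∈ Finset.Icc 1 T, ∫ ω, ‖X j ω‖ ^ 2 ∂μ ≤ M)
include hXM

lemma sum_integral_norm_sq_le [IsFiniteMeasure μ] (hw : IsLocalWeight w t T T₀ C)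
    (hT₀ : 1 ≤ T₀) (hM : 0 ≤ M) :
    ∑ j ∈ Finset.Icc 1 T, ∫ ω, ‖(w j / T₀) • ε j ω • X j ω‖ ^ 2 ∂μ ≤
      C ^ 2 * (σ ^ 2 * M) / T₀ := by
  have hterm (j : ℕ) (hj : j ∈ Finset.Icc 1 T) :
      ∫ ω, ‖(w j / T₀) • ε j ω • X j ω‖ ^ 2 ∂μ ≤ w j ^ 2 * (σ ^ 2 * M / T₀ ^ 2) := by
    have hεX : ∫ ω, ‖ε j ω • X j ω‖ ^ 2 ∂μ ≤ σ ^ 2 * M :=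
      (integral_norm_smul_sq_le (infoSet_le hXm hεm hj) (hε.memLp j hj) (hε.condVar_le j hj)
        (sq_nonneg σ) (stronglyMeasurable_infoSet_self hj) (hX j hj)).trans
        (mul_le_mul_of_nonneg_left (hXM j hj) (sq_nonneg σ))
    calc ∫ ω, ‖(w j / T₀) • ε j ω • X j ω‖ ^ 2 ∂μ
        = (w j / T₀) ^ 2 * ∫ ω, ‖ε j ω • X j ω‖ ^ 2 ∂μ := by
          simp only [norm_smul (w j / (T₀ : ℝ)), mul_pow, Real.norm_eq_abs, sq_abs,
            integral_const_mul]
      _ ≤ (w j / T₀) ^ 2 * (σ ^ 2 * M) := by gcongr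
      _ = w j ^ 2 * (σ ^ 2 * M / T₀ ^ 2) := by ring
  have : (0 : ℝ) < T₀ := by exact_mod_cast hT₀
  calc _ ≤ (∑ j ∈ Finset.Icc 1 T, w j ^ 2) * (σ ^ 2 * M / T₀ ^ 2) := by
        rw [Finset.sum_mul]
        exact Finset.sum_le_sum hterm
    _ ≤ C ^ 2 * T₀ * (σ ^ 2 * M / T₀ ^ 2) := by
        gcongr
        exact hw.sum_sq_le hT₀
    _ = C ^ 2 * (σ ^ 2 * M) / T₀ := by field_simp

lemma integral_norm_noiseScore_le [IsProbabilityMeasure μ] (hw : IsLocalWeight w t T T₀ C)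
    (hT₀ : 1 ≤ T₀) (hM : 0 ≤ M) (hp : 1 ≤ p) :
    ∫ ω, ‖noiseScore T T₀ w (fun j => ε j ω) fun j => X j ω‖ ∂μ ≤
      √(2 * Real.log (2 * p) * (C ^ 2 * (σ ^ 2 * M))) / √T₀ := by
  have : NeZero p := ⟨by omega⟩
  have hp' : (1 : ℝ) ≤ p := by exact_mod_cast hp
  have hlog : 0 ≤ Real.log (2 * p) := Real.log_nonneg (by linarith)
  rw [← Real.sqrt_div' _ (Nat.cast_nonneg T₀), mul_div_assoc]
  refine Real.le_sqrt_of_sq_le ?_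
  refine ((hε.isL2MartingaleDifference hXm hεm hX).smul fun j => w j / T₀).sq_integral_norm_sum_le
    |>.trans ?_
  rw [Fintype.card_fin]
  gcongr
  exact hε.sum_integral_norm_sq_le hXm hεm hX hXM hw hT₀ hM

lemma measure_noiseScore_ge_le [IsProbabilityMeasure μ] (hw : IsLocalWeight w t T T₀ C)
    (hT₀ : 1 ≤ T₀) (hM : 0 ≤ M) (hp : 2 ≤ p) :
    μ {ω | Real.log p ^ 2 / √T₀ / 8 ≤ ‖noiseScore T T₀ w (fun j => ε j ω) fun j => X j ω‖} ≤
      ENNReal.ofReal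
        (8 * (√(2 * Real.log (2 * p) * (C ^ 2 * (σ ^ 2 * M))) / Real.log p ^ 2)) := by
  have : (0 : ℝ) < T₀ := by exact_mod_cast hT₀
  have hlog : 0 < Real.log p := Real.log_pos (by exact_mod_cast hp)
  refine (measure_ge_le_of_integral_le (hε.integrable_noiseScore hXm hεm hX).norm
    (fun _ => norm_nonneg _) (by positivity)
    (hε.integral_norm_noiseScore_le hXm hεm hX hXM hw hT₀ hM (by omega))).trans_eq ?_
  congr 1
  field_simp

end IsBoundedVarianceMDS

end BoundedVariance

section Drift

variable {Ω : Type*} [MeasurableSpace Ω] {μ : Measure Ω} {p T T₀ t : ℕ} {X : ℕ → Ω → Fin p → ℝ}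
  {w : ℕ → ℝ} {M C : ℝ} {β₀ : ℕ → Fin p → ℝ} {β : Fin p → ℝ} {L : ℝ}

lemma integral_dotProduct_sq_le {x : Ω → Fin p → ℝ} (hx : MemLp x 2 μ) (b : Fin p → ℝ) :
    ∫ ω, (x ω ⬝ᵥ b) ^ 2 ∂μ ≤ l1Norm b ^ 2 * ∫ ω, ‖x ω‖ ^ 2 ∂μ := by
  rw [← integral_const_mul]
  refine integral_mono_of_nonneg (ae_of_all _ fun _ => sq_nonneg _)
    ((hx.integrable_norm_pow two_ne_zero).const_mul _) (ae_of_all _ fun ω => ?_)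
  calc (x ω ⬝ᵥ b) ^ 2 = |x ω ⬝ᵥ b| ^ 2 := (sq_abs _).symm
    _ ≤ (‖x ω‖ * l1Norm b) ^ 2 := by gcongr; exact abs_dotProduct_le _ _
    _ = l1Norm b ^ 2 * ‖x ω‖ ^ 2 := by ring

lemma integrable_dotProduct_sq {x : Ω → Fin p → ℝ} (hx : MemLp x 2 μ) (b : Fin p → ℝ) :
    Integrable (fun ω => (x ω ⬝ᵥ b) ^ 2) μ := by
  simp only [dotProduct]
  exact (memLp_finsetSum _ fun i _ => (hx.eval i).mul_const (b i)).integrable_sq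

lemma integrable_driftError (hX : ∀ j ∈ Finset.Icc 1 T, MemLp (X j) 2 μ) :
    Integrable (fun ω => driftError T T₀ w (fun j => X j ω) β₀ β) μ :=
  (integrable_finsetSum _ fun j hj =>
    (integrable_dotProduct_sq (hX j hj) _).const_mul (w j)).const_mul _

variable (hX : ∀ j ∈ Finset.Icc 1 T, MemLp (X j) 2 μ)
  (hXM : ∀ j ∈ Finset.Icc 1 T, ∫ ω, ‖X j ω‖ ^ 2 ∂μ ≤ M) (hM : 0 ≤ M)
  (hw : IsLocalWeight w t T T₀ C) (hT₀ : 1 ≤ T₀)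
  (hβ : ∀ j ∈ Finset.Icc 1 T, l1Norm (β₀ j - β) ≤ L * (|(j : ℝ) - t| / T))
include hX hXM hM hw hT₀ hβ

lemma integral_driftError_le :
    ∫ ω, driftError T T₀ w (fun j => X j ω) β₀ β ∂μ ≤ M * L ^ 2 * (C * ((T₀ : ℝ) / T) ^ 2) := by
  have hterm (j : ℕ) (hj : j ∈ Finset.Icc 1 T) :
      ∫ ω, (X j ω ⬝ᵥ (β₀ j - β)) ^ 2 ∂μ ≤ M * L ^ 2 * (|(j : ℝ) - t| / T) ^ 2 :=
    calc ∫ ω, (X j ω ⬝ᵥ (β₀ j - β)) ^ 2 ∂μ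
        ≤ l1Norm (β₀ j - β) ^ 2 * ∫ ω, ‖X j ω‖ ^ 2 ∂μ := integral_dotProduct_sq_le (hX j hj) _
      _ ≤ (L * (|(j : ℝ) - t| / T)) ^ 2 * M := by
        gcongr
        exacts [l1Norm_nonneg _, hβ j hj, hXM j hj]
      _ = M * L ^ 2 * (|(j : ℝ) - t| / T) ^ 2 := by ring
  calc ∫ ω, driftError T T₀ w (fun j => X j ω) β₀ β ∂μ
      = (1 / (T₀ : ℝ)) * ∑ j ∈ Finset.Icc 1 T, w j * ∫ ω, (X j ω ⬝ᵥ (β₀ j - β)) ^ 2 ∂μ := by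
        simp only [driftError]
        rw [integral_const_mul, integral_finsetSum _ fun j hj =>
          (integrable_dotProduct_sq (hX j hj) _).const_mul (w j)]
        simp only [integral_const_mul]
    _ ≤ (1 / (T₀ : ℝ)) *
          ∑ j ∈ Finset.Icc 1 T, w j * (M * L ^ 2 * (|(j : ℝ) - t| / T) ^ 2) := by
        refine mul_le_mul_of_nonneg_left (Finset.sum_le_sum fun j hj => ?_) (by positivity)
        exact mul_le_mul_of_nonneg_left (hterm j hj) (hw.nonneg j hj)
    _ = M * L ^ 2 *
          ((1 / (T₀ : ℝ)) * ∑ j ∈ Finset.Icc 1 T, w j * (|(j : ℝ) - t| / T) ^ 2) := by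
        simp only [mul_left_comm (w _), ← Finset.mul_sum]
        ring
    _ ≤ M * L ^ 2 * (C * ((T₀ : ℝ) / T) ^ 2) := by
        exact mul_le_mul_of_nonneg_left (hw.sum_mul_sq_le hT₀) (by positivity)

lemma measure_driftError_ge_le [IsFiniteMeasure μ] (hT : 1 ≤ T) {c : ℝ} (hc : 0 < c) :
    μ {ω | c * ((T₀ : ℝ) / T) / 8 ≤ driftError T T₀ w (fun j => X j ω) β₀ β} ≤
      ENNReal.ofReal (8 * (M * L ^ 2 * C) / c * ((T₀ : ℝ) / T)) := by
  have : (0 : ℝ) < T₀ := by exact_mod_cast hT₀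
  have : (0 : ℝ) < T := by exact_mod_cast hT
  refine (measure_ge_le_of_integral_le (integrable_driftError hX)
    (fun _ => driftError_nonneg hw.nonneg) (by positivity)
    (integral_driftError_le hX hXM hM hw hT₀ hβ)).trans_eq ?_
  congr 1
  field_simp

end Drift

lemma tendsto_sqrt_log_div_sq_log (K : ℝ) :
    Tendsto (fun x : ℝ => √(2 * Real.log (2 * x) * K) / Real.log x ^ 2) atTop (𝓝 0) := by
  have hinv : Tendsto (fun x : ℝ => (Real.log x)⁻¹) atTop (𝓝 0) :=
    Real.tendsto_log_atTop.inv_tendsto_atTop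
  have hlim : Tendsto (fun x : ℝ => √(2 * Real.log 2 * K * (Real.log x)⁻¹ ^ 4 +
      2 * K * (Real.log x)⁻¹ ^ 3)) atTop (𝓝 0) := by
    simpa using (((hinv.pow 4).const_mul (2 * Real.log 2 * K)).add
      ((hinv.pow 3).const_mul (2 * K))).sqrt
  refine hlim.congr' ?_
  filter_upwards [eventually_gt_atTop 1] with x hx
  have hlog : Real.log x ≠ 0 := (Real.log_pos hx).ne'
  rw [← Real.sqrt_sq (sq_nonneg (Real.log x)), ← Real.sqrt_div' _ (sq_nonneg _),
    Real.log_mul two_ne_zero (by linarith)]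
  congr 1
  field_simp

lemma measure_not_predictionError_le_le {Ω : Type*} [MeasurableSpace Ω] {μ : Measure Ω}
    [IsProbabilityMeasure μ] {p T T₀ t : ℕ} (hp : 2 ≤ p) (hT₀ : 1 ≤ T₀)
    (ht : t ∈ Finset.Icc 1 T) {w : ℕ → ℝ} {C : ℝ} (hw : IsLocalWeight w t T T₀ C)
    {X : ℕ → Ω → Fin p → ℝ} {ε y : ℕ → Ω → ℝ} (hXm : ∀ j ∈ Finset.Icc 1 T, Measurable (X j))
    (hεm : ∀ j ∈ Finset.Icc 1 T, Measurable (ε j)) {M : ℝ}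
    (hX : ∀ j ∈ Finset.Icc 1 T, MemLp (X j) 2 μ)
    (hXM : ∀ j ∈ Finset.Icc 1 T, ∫ ω, ‖X j ω‖ ^ 2 ∂μ ≤ M) {σ : ℝ}
    (hε : IsBoundedVarianceMDS μ X ε T σ) {β₀ : ℕ → Fin p → ℝ} {β : Fin p → ℝ} {L : ℝ}
    (hβ₀ : ∀ j ∈ Finset.Icc 1 T, l1Norm (β₀ j - β) ≤ L * (|(j : ℝ) - t| / T))
    {c : ℝ} (hc : 0 < c) (hβc : c ≤ l1Norm β)
    (hy : ∀ j ∈ Finset.Icc 1 T, ∀ ω, y j ω = X j ω ⬝ᵥ β₀ j + ε j ω) {βhat : Ω → Fin p → ℝ}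
    (hβhat : ∀ᵐ ω ∂μ, IsLasso T T₀ w (fun j => y j ω) (fun j => X j ω) (penaltyLevel p T T₀)
      (βhat ω)) :
    μ {ω | ¬ predictionError T T₀ w (fun j => X j ω) β (βhat ω) ≤
        3 * penaltyLevel p T T₀ * l1Norm β} ≤
      ENNReal.ofReal (8 * (√(2 * Real.log (2 * p) * (C ^ 2 * (σ ^ 2 * M))) / Real.log p ^ 2)) +
        ENNReal.ofReal (8 * (M * L ^ 2 * C) / c * ((T₀ : ℝ) / T)) := by
  have hT : 1 ≤ T := (Finset.mem_Icc.1 ht).1.trans (Finset.mem_Icc.1 ht).2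
  have hM : 0 ≤ M := (integral_nonneg fun _ => sq_nonneg _).trans (hXM t ht)
  refine le_trans ?_ ((measure_union_le _ _).trans (add_le_add
    (hε.measure_noiseScore_ge_le hXm hεm hX hXM hw hT₀ hM hp)
    (measure_driftError_ge_le hX hXM hM hw hT₀ hβ₀ hT hc)))
  refine measure_mono_ae ?_
  filter_upwards [hβhat] with ω hlasso hbad
  by_contra hgood
  obtain ⟨hnoise, hdrift⟩ := not_or.1 hgood
  refine hbad ?_
  have hlam : 0 ≤ penaltyLevel p T T₀ := le_trans (by positivity) div_le_penaltyLevel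
  refine hlasso.predictionError_le_three_mul hw.nonneg (fun j hj => hy j hj ω) hlam ?_ ?_
  · exact (not_le.1 hnoise).le.trans
      (div_le_div_of_nonneg_right sq_log_div_sqrt_le_penaltyLevel (by norm_num))
  · refine (not_le.1 hdrift).le.trans ?_
    rw [mul_comm c]
    gcongr
    exact div_le_penaltyLevel

end TVLasso

theorem theorem2_general
    {Ω : ℕ → Type*} [∀ n, MeasurableSpace (Ω n)]
    (μ : ∀ n, Measure (Ω n)) [∀ n, IsProbabilityMeasure (μ n)]
    (p T T₀ t : ℕ → ℕ)
    (hp : Tendsto p atTop atTop)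
    (hT₀ : ∀ n, 1 ≤ T₀ n)
    (hT₀T : Tendsto (fun n => (T₀ n : ℝ) / (T n : ℝ)) atTop (𝓝 0))
    (ht : ∀ n, t n ∈ Finset.Icc 1 (T n))
    (w : ∀ _ : ℕ, ℕ → ℝ) (C : ℝ)
    (hw : ∀ n, TVLasso.IsLocalWeight (w n) (t n) (T n) (T₀ n) C)
    (X : ∀ n, ℕ → Ω n → Fin (p n) → ℝ) (ε y : ∀ n, ℕ → Ω n → ℝ)
    (hXm : ∀ n, ∀ j ∈ Finset.Icc 1 (T n), Measurable (X n j))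
    (hεm : ∀ n, ∀ j ∈ Finset.Icc 1 (T n), Measurable (ε n j))
    (M : ℝ)
    (hX : ∀ n, ∀ j ∈ Finset.Icc 1 (T n),
      MemLp (X n j) 2 (μ n) ∧ ∫ ω, ‖X n j ω‖ ^ 2 ∂(μ n) ≤ M)
    (σ : ℝ)
    (hε : ∀ n, TVLasso.IsBoundedVarianceMDS (μ n) (X n) (ε n) (T n) σ)
    (β₀ : ∀ n, ℕ → Fin (p n) → ℝ) (L : ℝ)
    (hβ₀ : ∀ n, ∀ j ∈ Finset.Icc 1 (T n),
      TVLasso.l1Norm (β₀ n j - β₀ n (t n)) ≤ L * (|(j : ℝ) - (t n : ℝ)| / (T n : ℝ)))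
    (c : ℝ) (hc : 0 < c)
    (hβ₀c : ∀ᶠ n in atTop, c ≤ TVLasso.l1Norm (β₀ n (t n)))
    (hy : ∀ n, ∀ j ∈ Finset.Icc 1 (T n), ∀ ω, y n j ω = X n j ω ⬝ᵥ β₀ n j + ε n j ω)
    (βhat : ∀ n, Ω n → Fin (p n) → ℝ)
    (hβhat : ∀ n, ∀ᵐ ω ∂(μ n),
      TVLasso.IsLasso (T n) (T₀ n) (w n) (fun j => y n j ω) (fun j => X n j ω)
        (TVLasso.penaltyLevel (p n) (T n) (T₀ n)) (βhat n ω)) :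
    Tendsto
      (fun n => μ n {ω | ¬ TVLasso.predictionError (T n) (T₀ n) (w n) (fun j => X n j ω)
            (β₀ n (t n)) (βhat n ω)
          ≤ 3 * TVLasso.penaltyLevel (p n) (T n) (T₀ n) * TVLasso.l1Norm (β₀ n (t n))})
      atTop (𝓝 0) := by
  have hnoise := (TVLasso.tendsto_sqrt_log_div_sq_log (C ^ 2 * (σ ^ 2 * M))).comp
    (tendsto_natCast_atTop_atTop.comp hp)
  have hbound := (ENNReal.tendsto_ofReal (hnoise.const_mul 8)).add
    (ENNReal.tendsto_ofReal (hT₀T.const_mul (8 * (M * L ^ 2 * C) / c)))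
  simp only [mul_zero, ENNReal.ofReal_zero, add_zero] at hbound
  refine tendsto_of_tendsto_of_tendsto_of_le_of_le' tendsto_const_nhds hbound
    (Eventually.of_forall fun _ => zero_le) ?_
  filter_upwards [hp.eventually_ge_atTop 2, hβ₀c] with n hpn hcn
  exact TVLasso.measure_not_predictionError_le_le hpn (hT₀ n) (ht n) (hw n) (hXm n) (hεm n)
    (fun j hj => (hX n j hj).1) (fun j hj => (hX n j hj).2) (hε n) (hβ₀ n) hc hcn (hy n) (hβhat n)

/-- Asymptotics along an arbitrary sequence of models indexed by `n`, with sample size `T n`,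
number of predictors `p n`, effective window `T₀ n`, and target date `t n`. The exceptional
probability is an outer one, so no measurable selection of the minimizer is needed. -/
theorem theorem2
    {Ω : ℕ → Type*} [∀ n, MeasurableSpace (Ω n)]
    (μ : ∀ n, Measure (Ω n)) [∀ n, IsProbabilityMeasure (μ n)]
    (p T T₀ t : ℕ → ℕ)
    (hp : Tendsto p atTop atTop) (hT : Tendsto T atTop atTop)
    (hT₀ : ∀ n, 1 ≤ T₀ n)
    (hT₀T : Tendsto (fun n => (T₀ n : ℝ) / (T n : ℝ)) atTop (𝓝 0))
    (ht : ∀ n, t n ∈ Finset.Icc 1 (T n))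
    (w : ∀ _ : ℕ, ℕ → ℝ) (C : ℝ)
    (hw : ∀ n, TVLasso.IsLocalWeight (w n) (t n) (T n) (T₀ n) C)
    (X : ∀ n, ℕ → Ω n → Fin (p n) → ℝ) (ε y : ∀ n, ℕ → Ω n → ℝ)
    (hXm : ∀ n, ∀ j ∈ Finset.Icc 1 (T n), Measurable (X n j))
    (hεm : ∀ n, ∀ j ∈ Finset.Icc 1 (T n), Measurable (ε n j))
    -- the moments of the predictors (in sup norm, the weakest choice) are uniformly bounded
    (M : ℝ)
    (hX : ∀ n, ∀ j ∈ Finset.Icc 1 (T n),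
      MemLp (X n j) 2 (μ n) ∧ ∫ ω, ‖X n j ω‖ ^ 2 ∂(μ n) ≤ M)
    (σ : ℝ)
    (hε : ∀ n, TVLasso.IsHomoskedasticMDS (μ n) (X n) (ε n) (T n) σ)
    -- the true coefficients: Lipschitz in rescaled time, and not vanishing at date `t`
    (β₀ : ∀ n, ℕ → Fin (p n) → ℝ) (L : ℝ)
    (hβ₀ : ∀ n, ∀ j ∈ Finset.Icc 1 (T n),
      TVLasso.l1Norm (β₀ n j - β₀ n (t n)) ≤ L * (|(j : ℝ) - (t n : ℝ)| / (T n : ℝ)))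
    (c : ℝ) (hc : 0 < c)
    (hβ₀c : ∀ᶠ n in atTop, c ≤ TVLasso.l1Norm (β₀ n (t n)))
    (hy : ∀ n, ∀ j ∈ Finset.Icc 1 (T n), ∀ ω, y n j ω = X n j ω ⬝ᵥ β₀ n j + ε n j ω)
    (βhat : ∀ n, Ω n → Fin (p n) → ℝ)
    (hβhat : ∀ n, ∀ᵐ ω ∂(μ n),
      TVLasso.IsLasso (T n) (T₀ n) (w n) (fun j => y n j ω) (fun j => X n j ω)
        (TVLasso.penaltyLevel (p n) (T n) (T₀ n)) (βhat n ω)) :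
    Tendsto
      (fun n => μ n {ω | ¬ TVLasso.predictionError (T n) (T₀ n) (w n) (fun j => X n j ω)
            (β₀ n (t n)) (βhat n ω)
          ≤ 3 * TVLasso.penaltyLevel (p n) (T n) (T₀ n) * TVLasso.l1Norm (β₀ n (t n))})
      atTop (𝓝 0) :=
  theorem2_general μ p T T₀ t hp hT₀ hT₀T ht w C hw X ε y hXm hεm M hX σ
    (fun n => (hε n).isBoundedVarianceMDS) β₀ L hβ₀ c hc hβ₀c hy βhat hβhat
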